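/- Let $\mathcal V$ be a finite-dimensional real vector space and $\sigma:\mathcal V\times\mathcal V\to\mathbb R$ a positive definite bilinear form. Let $\mathcal V_1,\mathcal V_2\subset\mathcal V$ be dual cones with respect to $\sigma$, i.e. non-empty open subsets, with closures $\overline{\mathcal V}_1,\overline{\mathcal V}_2$, such that (a) $\sigma(x,y)>0$ for all $x\in\mathcal V_1$, $y\in\mathcal V_2$; (b) for every $x\in\mathcal V\setminus\mathcal V_1$ there is $y\in\overline{\mathcal V}_2\setminus\{0\}$ with $\sigma(x,y)\le 0$, and for every $y\in\mathcal V\setminus\mathcal V_2$ there is $x\in\overline{\mathcal V}_1\setminus\{0\}$ with $\sigma(x,y)\le 0$. Let $\Omega\le \mathrm{GL}(\mathcal V)$ be a group, acting from the right, that leaves $\mathcal V_1$ invariant and acts properly discontinuously on it, and let $\Omega^{ad}=\{\omega^{ad}\mid\omega\in\Omega\}$, where $\omega^{ad}\in\mathrm{GL}(\mathcal V)$ is the unique element with $\sigma(x\omega,y)=\sigma(x,y\omega^{ad})$ for all $x,y\in\mathcal V$. Let $L$ be a full lattice in $\mathcal V$ and let $D\subseteq(\overline{\mathcal V}_2\cap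 L)\setminus\{0\}$ be admissible, i.e. for every $x\in\partial\mathcal V_1$ and every $\varepsilon>0$ there is $d\in D$ with $\sigma(x,d)<\varepsilon$. Assume that $L\Omega^{ad}=L$ and $D\Omega^{ad}=D$. For $x\in\mathcal V_1$ let $\mu_D(x)=\min_{d\in D}\sigma(x,d)$ be its $D$-minimum, and call $x$ $D$-perfect if the set $\{d\in D\mid\sigma(x,d)=\mu_D(x)\}$ spans $\mathcal V$. Then the following are equivalent: (1) there are only finitely many $\Omega$-equivalence classes of $D$-perfect points with $D$-minimum $1$; (2) there are a set $\tilde{\mathbb F}\subset\mathcal V_2$ such that for every $y\in\mathcal V_2$ there is $\omega\in\Omega$ with $y\omega^{ad}\in\tilde{\mathbb F}$, and a point $y_0\in\mathcal V_2$, such that $d-y_0\in\overline{\mathcal V}_2$ for all $d\in\tilde{\mathbb F}\cap L$. -/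

import Mathlib

namespace DualCones

variable {V : Type*} [NormedAddCommGroup V] [NormedSpace ℝ V]

/-- A bilinear form is positive definite: `σ x x > 0` for all `x ≠ 0`
(symmetry is not required). -/
def IsPosDefForm (σ : LinearMap.BilinForm ℝ V) : Prop :=
  ∀ x : V, x ≠ 0 → 0 < σ x x

/-- `V₁` and `V₂` are dual cones with respect to `σ`. The closed cones of the theory are
`closure V₁` and `closure V₂`. -/
structure IsDualCones (σ : LinearMap.BilinForm ℝ V) (V₁ V₂ : Set V) : Prop where
  nonempty_left : V₁.Nonempty
  nonempty_right : V₂.Nonempty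
  isOpen_left : IsOpen V₁
  isOpen_right : IsOpen V₂
  pos : ∀ x ∈ V₁, ∀ y ∈ V₂, 0 < σ x y
  exists_of_notMem_left : ∀ x, x ∉ V₁ → ∃ y ∈ closure V₂ \ {0}, σ x y ≤ 0
  exists_of_notMem_right : ∀ y, y ∉ V₂ → ∃ x ∈ closure V₁ \ {0}, σ x y ≤ 0

/-- `D` is a discrete subset of `closure V₂ \ {0}` which is admissible: on every boundary point
`x` of `V₁` the form `σ x` takes values smaller than any given `ε > 0` on `D`. -/
structure IsAdmissible (σ : LinearMap.BilinForm ℝ V) (V₁ V₂ D : Set V) : Prop where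
  subset : D ⊆ closure V₂ \ {0}
  discrete : DiscreteTopology D
  exists_lt : ∀ x ∈ frontier V₁, ∀ ε : ℝ, 0 < ε → ∃ d ∈ D, σ x d < ε

/-- The `D`-minimum of `x`, that is, the minimum of `σ x d` over `d ∈ D`. -/
noncomputable def minimum (σ : LinearMap.BilinForm ℝ V) (D : Set V) (x : V) : ℝ :=
  sInf ((fun d => σ x d) '' D)

/-- The set of `D`-minimal vectors of `x`. -/
def minimalVectors (σ : LinearMap.BilinForm ℝ V) (D : Set V) (x : V) : Set V :=
  {d | d ∈ D ∧ σ x d = minimum σ D x}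

/-- `x ∈ V₁` is `D`-perfect: its `D`-minimal vectors span a space of full dimension. -/
def IsPerfect (σ : LinearMap.BilinForm ℝ V) (V₁ D : Set V) (x : V) : Prop :=
  x ∈ V₁ ∧
    Module.finrank ℝ (Submodule.span ℝ (minimalVectors σ D x)) = Module.finrank ℝ V

/-- The set `P_D` of `D`-perfect points with `D`-minimum `1`. -/
def perfectPoints (σ : LinearMap.BilinForm ℝ V) (V₁ D : Set V) : Set V :=
  {x | IsPerfect σ V₁ D x ∧ minimum σ D x = 1}

/-- The equivalence relation on a set `P` of vectors of lying in the same orbit under `Ω`. -/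
def orbitSetoid (Ω : Subgroup (V ≃ₗ[ℝ] V)) (P : Set V) : Setoid P where
  r x y := ∃ ω ∈ Ω, ω (x : V) = (y : V)
  iseqv :=
    { refl := fun _ => ⟨1, Ω.one_mem, rfl⟩
      symm := fun {x y} ⟨ω, hω, h⟩ => ⟨ω⁻¹, Ω.inv_mem hω, by
        rw [← h]; exact ω.symm_apply_apply (x : V)⟩
      trans := fun {x y z} ⟨ω, hω, h⟩ ⟨ω', hω', h'⟩ => ⟨ω' * ω, Ω.mul_mem hω' hω, by
        rw [← h', ← h]; rfl⟩ }

/-- `Ω` leaves the set `C` invariant and acts properly discontinuously on it: for compact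
`K ⊆ C` only finitely many `ω ∈ Ω` move some point of `K` into `K`. -/
def ActsProperlyDiscontinuously (Ω : Subgroup (V ≃ₗ[ℝ] V)) (C : Set V) : Prop :=
  (∀ ω ∈ Ω, (fun v => ω v) '' C = C) ∧
    ∀ K ⊆ C, IsCompact K → {ω | ω ∈ Ω ∧ (((fun v => ω v) '' K) ∩ K).Nonempty}.Finite

/-- `τ` is the adjoint of `ω` with respect to `σ`. -/
def IsAdjoint (σ : LinearMap.BilinForm ℝ V) (ω τ : V ≃ₗ[ℝ] V) : Prop :=
  ∀ x y, σ (ω x) y = σ x (τ y)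

/-- The adjoint group of `Ω`, as a set of automorphisms. -/
def adjointGroup (σ : LinearMap.BilinForm ℝ V) (Ω : Subgroup (V ≃ₗ[ℝ] V)) :
    Set (V ≃ₗ[ℝ] V) :=
  {τ | ∃ ω ∈ Ω, IsAdjoint σ ω τ}

/-- For a positive definite form every automorphism has exactly one adjoint automorphism. -/
theorem existsUnique_isAdjoint [FiniteDimensional ℝ V] (σ : LinearMap.BilinForm ℝ V)
    (hσ : IsPosDefForm σ) (ω : V ≃ₗ[ℝ] V) : ∃! τ : V ≃ₗ[ℝ] V, IsAdjoint σ ω τ := by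
  have hinj : Function.Injective (LinearMap.flip σ) := by
    rw [injective_iff_map_eq_zero]
    intro y hy
    by_contra hne
    have h := hσ y hne
    have h0 : LinearMap.flip σ y y = 0 := by rw [hy]; rfl
    rw [LinearMap.flip_apply] at h0
    exact h.ne' h0
  have hdim : Module.finrank ℝ V = Module.finrank ℝ (Module.Dual ℝ V) :=
    Subspace.dual_finrank_eq.symm
  let e : V ≃ₗ[ℝ] Module.Dual ℝ V := LinearEquiv.ofInjectiveOfFinrankEq (LinearMap.flip σ) hinj hdim
  have he : ∀ y x, e y x = σ x y := fun y x => rfl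
  refine ⟨(e.trans (LinearEquiv.dualMap ω)).trans e.symm, ?_, ?_⟩
  · intro x y
    rw [← he, ← he]
    simp [LinearEquiv.dualMap_apply]
  · intro τ hτ
    ext y
    apply e.injective
    ext x
    rw [he, ← hτ x y, ← he]
    simp [LinearEquiv.dualMap_apply]

/-- `F` is a pseudo-fundamental set for the action of `Ω^ad` on `V₂`: a subset of `V₂` that
meets every `Ω^ad`-orbit in `V₂`. -/
def IsPseudoFundamental (σ : LinearMap.BilinForm ℝ V) (Ω : Subgroup (V ≃ₗ[ℝ] V))
    (V₂ F : Set V) : Prop :=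
  F ⊆ V₂ ∧ ∀ y ∈ V₂, ∃ τ ∈ adjointGroup σ Ω, τ y ∈ F

end DualCones

namespace DualCones

open Topology

/-! ### Dual cones, and linear growth of the form on them. -/

section Cones

variable {V : Type*} [NormedAddCommGroup V] [NormedSpace ℝ V]
  {σ : LinearMap.BilinForm ℝ V} {V₁ V₂ D : Set V}

/-! The geometry is that of the convex set `ryshkov`: admissibility keeps it inside `V₁`, it is
locally polyhedral there, and the perfect points with minimum `1` behave as its vertices. The cone
over the minimal vectors of such a point is its Voronoi domain.

(1) ⇒ (2): minimising `σ · y` over `ryshkov` and taking an extreme minimiser shows that the Voronoi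
domains cover `V₂` (`exists_mem_perfectPoints`). Hence the domains of orbit representatives form a
pseudo-fundamental set. In each of them, removing integral multiples of the generators leaves
finitely many lattice points of `V₂` that bound all others from below (`exists_finite_dominated`),
and some `y₀` lies below all of these.

(2) ⇒ (1): with `n = dim V`, a perfect `x` has value `n` on the sum `s` of `n` independent minimal
vectors, and `s` is a lattice point of `V₂`. Moving `s` into `F` replaces `x` by an equivalent point
with value at most `n` on `y₀`. Such points of `ryshkov` form a compact subset of `V₁`, which
contains only finitely many perfect points (`finite_perfectPoints_inter`). -/

theorem IsPosDefForm.flip (hσ : IsPosDefForm σ) : IsPosDefForm (LinearMap.flip σ) :=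
  fun x hx => hσ x hx

theorem IsDualCones.flip (hV : IsDualCones σ V₁ V₂) :
    IsDualCones (LinearMap.flip σ) V₂ V₁ where
  nonempty_left := hV.nonempty_right
  nonempty_right := hV.nonempty_left
  isOpen_left := hV.isOpen_right
  isOpen_right := hV.isOpen_left
  pos x hx y hy := hV.pos y hy x hx
  exists_of_notMem_left := hV.exists_of_notMem_right
  exists_of_notMem_right := hV.exists_of_notMem_left

theorem eventually_add_smul_mem {U : Set V} (hU : IsOpen U) {x : V} (hx : x ∈ U) (z : V) :
    ∀ᶠ t : ℝ in 𝓝[>] 0, x + t • z ∈ U := by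
  have hc : Continuous fun t : ℝ => x + t • z := by fun_prop
  exact (hc.continuousAt.eventually (hU.mem_nhds (by simpa using hx))).filter_mono
    nhdsWithin_le_nhds

theorem IsDualCones.zero_notMem_left (hV : IsDualCones σ V₁ V₂) : (0 : V) ∉ V₁ := by
  intro h
  obtain ⟨y, hy⟩ := hV.nonempty_right
  simpa using hV.pos 0 h y hy

/-- The part of `closure V₁` on which the form with every element of `D` is at least `1`. -/
def ryshkov (σ : LinearMap.BilinForm ℝ V) (V₁ D : Set V) : Set V :=
  {x | x ∈ closure V₁ ∧ ∀ d ∈ D, 1 ≤ σ x d}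

theorem IsAdmissible.ryshkov_subset (hV : IsDualCones σ V₁ V₂) (hD : IsAdmissible σ V₁ V₂ D) :
    ryshkov σ V₁ D ⊆ V₁ := by
  rintro x ⟨hx, h⟩
  by_contra hxV
  obtain ⟨d, hd, hlt⟩ := hD.exists_lt x (by rw [hV.isOpen_left.frontier_eq]; exact ⟨hx, hxV⟩)
    1 one_pos
  exact hlt.not_ge (h d hd)

theorem minimum_eq_of_forall_le {x d : V} (hd : d ∈ D) (h : ∀ e ∈ D, σ x d ≤ σ x e) :
    minimum σ D x = σ x d :=
  IsLeast.csInf_eq ⟨⟨d, hd, rfl⟩, by rintro _ ⟨e, he, rfl⟩; exact h e he⟩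

theorem IsPosDefForm.eq_of_forall_eq_of_span_eq_top (hσ : IsPosDefForm σ) {x y : V} {S : Set V}
    (hS : Submodule.span ℝ S = ⊤) (h : ∀ d ∈ S, σ x d = σ y d) : x = y := by
  have hxy : σ x = σ y := LinearMap.ext_on hS h
  by_contra hne
  have h0 := hσ (x - y) (sub_ne_zero.2 hne)
  have h1 : σ (x - y) = 0 := by rw [map_sub, hxy, sub_self]
  rw [h1] at h0
  exact lt_irrefl _ h0

theorem IsAdmissible.nonempty (hV : IsDualCones σ V₁ V₂) (hD : IsAdmissible σ V₁ V₂ D) :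
    D.Nonempty := by
  have hne : (frontier V₁).Nonempty := by
    rw [nonempty_frontier_iff]
    exact ⟨hV.nonempty_left, fun h => hV.zero_notMem_left (h ▸ Set.mem_univ _)⟩
  obtain ⟨x, hx⟩ := hne
  obtain ⟨d, hd, -⟩ := hD.exists_lt x hx 1 one_pos
  exact ⟨d, hd⟩

variable [FiniteDimensional ℝ V]

theorem continuous_uncurry_form (σ : LinearMap.BilinForm ℝ V) :
    Continuous fun p : V × V => σ p.1 p.2 :=
  (LinearMap.toContinuousBilinearMap σ).continuous₂

theorem continuous_form_right (σ : LinearMap.BilinForm ℝ V) (x : V) :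
    Continuous fun y => σ x y :=
  LinearMap.continuous_of_finiteDimensional (σ x)

theorem continuous_form_left (σ : LinearMap.BilinForm ℝ V) (y : V) :
    Continuous fun x => σ x y :=
  continuous_form_right (LinearMap.flip σ) y

/-- Every linear functional is represented by the left argument of a positive definite form. -/
theorem IsPosDefForm.exists_eq (hσ : IsPosDefForm σ) (f : V →ₗ[ℝ] ℝ) :
    ∃ z, ∀ y, σ z y = f y := by
  have hinj : Function.Injective σ := by
    rw [injective_iff_map_eq_zero]
    intro y hy
    by_contra hne
    have h := hσ y hne
    rw [hy] at h
    exact lt_irrefl _ h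
  have hdim : Module.finrank ℝ V = Module.finrank ℝ (Module.Dual ℝ V) :=
    Subspace.dual_finrank_eq.symm
  obtain ⟨z, hz⟩ := (LinearMap.injective_iff_surjective_of_finrank_eq_finrank hdim).1 hinj f
  exact ⟨z, fun y => by rw [hz]⟩

theorem IsDualCones.nonneg (hV : IsDualCones σ V₁ V₂) {x y : V} (hx : x ∈ closure V₁)
    (hy : y ∈ closure V₂) : 0 ≤ σ x y := by
  have hxy : (x, y) ∈ closure (V₁ ×ˢ V₂) := by
    rw [closure_prod_eq]; exact ⟨hx, hy⟩
  have hcl : IsClosed {p : V × V | 0 ≤ σ p.1 p.2} :=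
    isClosed_le continuous_const (continuous_uncurry_form σ)
  exact closure_minimal (fun p hp => (hV.pos p.1 hp.1 p.2 hp.2).le) hcl hxy

theorem IsDualCones.mem_left_iff (hσ : IsPosDefForm σ) (hV : IsDualCones σ V₁ V₂) {x : V} :
    x ∈ V₁ ↔ ∀ y ∈ closure V₂ \ {0}, 0 < σ x y := by
  constructor
  · rintro hx y ⟨hy, hy0⟩
    -- Openness gives `x - t • y ∈ V₁` for a small `t > 0`, so `σ x y ≥ t * σ y y > 0`.
    obtain ⟨t, ht, ht0⟩ := ((eventually_add_smul_mem hV.isOpen_left hx (-y)).and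
      self_mem_nhdsWithin).exists
    have h1 := hV.nonneg (subset_closure ht) hy
    have h2 : 0 < t * σ y y := mul_pos ht0 (hσ y hy0)
    simp only [smul_neg, map_add, map_neg, map_smul, LinearMap.add_apply, LinearMap.neg_apply,
      LinearMap.smul_apply, smul_eq_mul] at h1
    linarith
  · intro h
    by_contra hx
    obtain ⟨y, hy, hle⟩ := hV.exists_of_notMem_left x hx
    exact (h y hy).not_ge hle

theorem IsDualCones.mem_right_iff (hσ : IsPosDefForm σ) (hV : IsDualCones σ V₁ V₂) {y : V} :
    y ∈ V₂ ↔ ∀ x ∈ closure V₁ \ {0}, 0 < σ x y :=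
  hV.flip.mem_left_iff hσ.flip

theorem IsDualCones.mem_closure_left_iff (hσ : IsPosDefForm σ) (hV : IsDualCones σ V₁ V₂)
    {x : V} : x ∈ closure V₁ ↔ ∀ y ∈ closure V₂, 0 ≤ σ x y := by
  refine ⟨fun hx y hy => hV.nonneg hx hy, fun h => ?_⟩
  obtain ⟨v, hv⟩ := hV.nonempty_left
  have hc : Continuous fun t : ℝ => x + t • v := by fun_prop
  have ht : Filter.Tendsto (fun t : ℝ => x + t • v) (𝓝[>] 0) (𝓝 x) := by
    have := hc.tendsto 0
    simp only [zero_smul, add_zero] at this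
    exact this.mono_left nhdsWithin_le_nhds
  refine mem_closure_of_tendsto ht ?_
  filter_upwards [self_mem_nhdsWithin] with t ht
  rw [hV.mem_left_iff hσ]
  intro y hy
  have h1 := h y hy.1
  have h2 := mul_pos (Set.mem_Ioi.1 ht) ((hV.mem_left_iff hσ).1 hv y hy)
  simp only [map_add, map_smul, LinearMap.add_apply, LinearMap.smul_apply, smul_eq_mul]
  linarith

theorem IsDualCones.mem_closure_right_iff (hσ : IsPosDefForm σ) (hV : IsDualCones σ V₁ V₂)
    {y : V} : y ∈ closure V₂ ↔ ∀ x ∈ closure V₁, 0 ≤ σ x y :=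
  hV.flip.mem_closure_left_iff hσ.flip

theorem IsDualCones.smul_mem_closure_left (hσ : IsPosDefForm σ) (hV : IsDualCones σ V₁ V₂)
    {x : V} (hx : x ∈ closure V₁) {t : ℝ} (ht : 0 ≤ t) : t • x ∈ closure V₁ := by
  rw [hV.mem_closure_left_iff hσ] at hx ⊢
  intro y hy
  simpa using mul_nonneg ht (hx y hy)

theorem IsDualCones.smul_mem_left (hσ : IsPosDefForm σ) (hV : IsDualCones σ V₁ V₂)
    {x : V} (hx : x ∈ V₁) {t : ℝ} (ht : 0 < t) : t • x ∈ V₁ := by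
  rw [hV.mem_left_iff hσ] at hx ⊢
  intro y hy
  simpa using mul_pos ht (hx y hy)

/-- On a compact subset of `V₁` the form grows at least linearly in the second argument. -/
theorem IsDualCones.exists_mul_norm_le (hσ : IsPosDefForm σ) (hV : IsDualCones σ V₁ V₂)
    {K : Set V} (hK : IsCompact K) (hKV : K ⊆ V₁) :
    ∃ c : ℝ, 0 < c ∧ ∀ x ∈ K, ∀ y ∈ closure V₂, c * ‖y‖ ≤ σ x y := by
  have hS : IsCompact (closure V₂ ∩ Metric.sphere (0 : V) 1) :=
    (isCompact_sphere 0 1).inter_left isClosed_closure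
  have hpos : ∀ p ∈ K ×ˢ (closure V₂ ∩ Metric.sphere (0 : V) 1), 0 < σ p.1 p.2 := by
    rintro ⟨x, y⟩ ⟨hx, hy, hy1⟩
    refine (hV.mem_left_iff hσ).1 (hKV hx) y ⟨hy, ?_⟩
    rintro rfl
    simp at hy1
  obtain ⟨c, hc, hle⟩ : ∃ c : ℝ, 0 < c ∧
      ∀ p ∈ K ×ˢ (closure V₂ ∩ Metric.sphere (0 : V) 1), c ≤ σ p.1 p.2 := by
    rcases (K ×ˢ (closure V₂ ∩ Metric.sphere (0 : V) 1)).eq_empty_or_nonempty with he | hne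
    · exact ⟨1, one_pos, by simp [he]⟩
    · obtain ⟨p, hp, hmin⟩ := (hK.prod hS).exists_isMinOn hne
        (continuous_uncurry_form σ).continuousOn
      exact ⟨_, hpos p hp, fun q hq => hmin hq⟩
  refine ⟨c, hc, fun x hx y hy => ?_⟩
  rcases eq_or_ne y 0 with rfl | hy0
  · simp
  have hn : 0 < ‖y‖ := norm_pos_iff.2 hy0
  have h := hle (x, ‖y‖⁻¹ • y) ⟨hx,
    hV.flip.smul_mem_closure_left hσ.flip hy (inv_nonneg.2 hn.le), by
      simp [norm_smul, hn.ne']⟩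
  simp only [map_smul, smul_eq_mul] at h
  rw [inv_mul_eq_div, le_div_iff₀ hn] at h
  exact h

theorem IsDualCones.isCompact_setOf_le (hσ : IsPosDefForm σ) (hV : IsDualCones σ V₁ V₂)
    {y : V} (hy : y ∈ V₂) (C : ℝ) : IsCompact {x | x ∈ closure V₁ ∧ σ x y ≤ C} := by
  obtain ⟨c, hc, h⟩ := hV.flip.exists_mul_norm_le hσ.flip isCompact_singleton
    (Set.singleton_subset_iff.2 hy)
  refine (isCompact_closedBall (0 : V) (C / c)).of_isClosed_subset
    (isClosed_closure.inter (isClosed_le (continuous_form_left σ y) continuous_const)) ?_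
  rintro x ⟨hx, hxC⟩
  rw [mem_closedBall_zero_iff, le_div_iff₀ hc, mul_comm]
  exact (h y rfl x hx).trans hxC

theorem finite_lattice_norm_le (L : Submodule ℤ V) [DiscreteTopology L] (r : ℝ) :
    {d | d ∈ L ∧ ‖d‖ ≤ r}.Finite := by
  have h : ((Metric.closedBall (0 : V) r) ∩ L.toAddSubgroup).Finite := by
    have : DiscreteTopology L.toAddSubgroup := (inferInstance : DiscreteTopology L)
    exact Metric.finite_isBounded_inter_isClosed DiscreteTopology.isDiscrete
      Metric.isBounded_closedBall inferInstance
  exact h.subset fun d hd => ⟨mem_closedBall_zero_iff.2 hd.2, hd.1⟩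

theorem isClosed_ryshkov : IsClosed (ryshkov σ V₁ D) := by
  have : ryshkov σ V₁ D = closure V₁ ∩ ⋂ d ∈ D, {x | 1 ≤ σ x d} := by
    ext x; simp [ryshkov]
  rw [this]
  exact isClosed_closure.inter (isClosed_biInter fun d _ =>
    isClosed_le continuous_const (continuous_form_left σ d))

theorem IsPerfect.span_eq_top {x : V} (hx : IsPerfect σ V₁ D x) :
    Submodule.span ℝ (minimalVectors σ D x) = ⊤ :=
  Submodule.eq_top_of_finrank_eq hx.2

/-- A perfect point has minimal vectors whose sum is a lattice point of `V₂` on which it takes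
the dimension as value. -/
theorem IsDualCones.exists_mem_right_of_isPerfect {L : Submodule ℤ V}
    (hσ : IsPosDefForm σ) (hV : IsDualCones σ V₁ V₂) (hDL : D ⊆ (closure V₂ ∩ (L : Set V)) \ {0}) {x : V}
    (hx : x ∈ perfectPoints σ V₁ D) :
    ∃ s ∈ V₂, s ∈ L ∧ σ x s = Module.finrank ℝ V := by
  obtain ⟨S, hSM, hcard, hspan, -⟩ :=
    Submodule.exists_finset_span_eq_linearIndepOn ℝ (minimalVectors σ D x)
  rw [hx.1.span_eq_top] at hspan
  refine ⟨∑ d ∈ S, d, ?_, Submodule.sum_mem _ fun d hd => (hDL (hSM hd).1).1.2, ?_⟩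
  · rw [hV.mem_right_iff hσ]
    rintro v ⟨hv, hv0⟩
    have hnn : ∀ d ∈ S, 0 ≤ σ v d := fun d hd => hV.nonneg hv (hDL (hSM hd).1).1.1
    rw [map_sum]
    -- If the sum vanished, `σ v` would vanish on a spanning set, forcing `v = 0`.
    refine (Finset.sum_nonneg hnn).lt_of_ne fun h0 => hv0 ?_
    refine hσ.eq_of_forall_eq_of_span_eq_top hspan fun d hd => ?_
    rw [(Finset.sum_eq_zero_iff_of_nonneg hnn).1 h0.symm d hd]
    simp
  · rw [map_sum, Finset.sum_congr rfl fun d hd => ((hSM hd).2.trans hx.2), Finset.sum_const, hcard,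
      hx.1.2]
    simp

/-! ### Finiteness from the lattice, and the covering of `V₂` by Voronoi domains. -/

section Lattice

variable {L : Submodule ℤ V} [DiscreteTopology L]

theorem IsDualCones.finite_setOf_le (hσ : IsPosDefForm σ) (hV : IsDualCones σ V₁ V₂)
    (hDL : D ⊆ (closure V₂ ∩ (L : Set V)) \ {0}) {x : V} (hx : x ∈ V₁) (C : ℝ) :
    {d | d ∈ D ∧ σ x d ≤ C}.Finite := by
  obtain ⟨c, hc, h⟩ := hV.exists_mul_norm_le hσ isCompact_singleton
    (Set.singleton_subset_iff.2 hx)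
  refine (finite_lattice_norm_le L (C / c)).subset ?_
  rintro d ⟨hd, hdC⟩
  refine ⟨(hDL hd).1.2, ?_⟩
  rw [le_div_iff₀ hc, mul_comm]
  exact (h x rfl d (hDL hd).1.1).trans hdC

theorem IsDualCones.exists_forall_le (hσ : IsPosDefForm σ) (hV : IsDualCones σ V₁ V₂)
    (hDL : D ⊆ (closure V₂ ∩ (L : Set V)) \ {0}) (hne : D.Nonempty) {x : V} (hx : x ∈ V₁) :
    ∃ d ∈ D, ∀ e ∈ D, σ x d ≤ σ x e := by
  obtain ⟨d₀, hd₀⟩ := hne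
  obtain ⟨d, hd, hmin⟩ := Set.exists_min_image _ (σ x)
    (hV.finite_setOf_le hσ hDL hx (σ x d₀)) ⟨d₀, hd₀, le_rfl⟩
  refine ⟨d, hd.1, fun e he => ?_⟩
  rcases le_total (σ x e) (σ x d₀) with h | h
  · exact hmin e ⟨he, h⟩
  · exact hd.2.trans h

theorem IsDualCones.minimum_le (hV : IsDualCones σ V₁ V₂)
    (hDL : D ⊆ closure V₂) {x d : V} (hx : x ∈ V₁) (hd : d ∈ D) :
    minimum σ D x ≤ σ x d := by
  refine csInf_le ⟨0, ?_⟩ ⟨d, hd, rfl⟩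
  rintro _ ⟨e, he, rfl⟩
  exact hV.nonneg (subset_closure hx) (hDL he)

theorem IsDualCones.nonempty_ryshkov (hσ : IsPosDefForm σ) (hV : IsDualCones σ V₁ V₂)
    (hDL : D ⊆ (closure V₂ ∩ (L : Set V)) \ {0}) (hne : D.Nonempty) :
    (ryshkov σ V₁ D).Nonempty := by
  obtain ⟨x, hx⟩ := hV.nonempty_left
  obtain ⟨d, hd, hmin⟩ := hV.exists_forall_le hσ hDL hne hx
  have hpos : 0 < σ x d := (hV.mem_left_iff hσ).1 hx d ⟨(hDL hd).1.1, (hDL hd).2⟩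
  refine ⟨(σ x d)⁻¹ • x, subset_closure (hV.smul_mem_left hσ hx (inv_pos.2 hpos)), fun e he => ?_⟩
  simp only [map_smul, LinearMap.smul_apply, smul_eq_mul]
  rw [inv_mul_eq_div, le_div_iff₀ hpos, one_mul]
  exact hmin e he

/-- A direction which is nonnegative on the vectors of value `1` stays inside the domain. -/
theorem IsDualCones.eventually_mem_ryshkov (hσ : IsPosDefForm σ) (hV : IsDualCones σ V₁ V₂)
    (hDL : D ⊆ (closure V₂ ∩ (L : Set V)) \ {0}) {x z : V} (hx : x ∈ V₁)
    (hx1 : ∀ d ∈ D, 1 ≤ σ x d) (hz : ∀ d ∈ D, σ x d = 1 → 0 ≤ σ z d) :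
    ∀ᶠ t : ℝ in 𝓝[>] 0, x + t • z ∈ ryshkov σ V₁ D := by
  obtain ⟨s, hs, hs0⟩ := ((eventually_add_smul_mem hV.isOpen_left hx z).and
    self_mem_nhdsWithin).exists
  have hs0 : 0 < s := hs0
  -- Only the finitely many `d` with value at most `1` at `x + s • z` need care. For the others the
  -- constraint holds at both ends of the segment from `x` to `x + s • z`, hence along it.
  have hfin := hV.finite_setOf_le hσ hDL hs 1
  have hev : ∀ᶠ t : ℝ in 𝓝[>] 0, ∀ d ∈ {d | d ∈ D ∧ σ (x + s • z) d ≤ 1},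
      1 ≤ σ (x + t • z) d := by
    rw [Filter.eventually_all_finite hfin]
    rintro d ⟨hd, -⟩
    rcases (hx1 d hd).eq_or_lt with h | h
    · filter_upwards [self_mem_nhdsWithin] with t ht
      have := mul_nonneg (le_of_lt (Set.mem_Ioi.1 ht)) (hz d hd h.symm)
      simp only [map_add, map_smul, LinearMap.add_apply, LinearMap.smul_apply, smul_eq_mul]
      linarith
    · filter_upwards [eventually_add_smul_mem
        (isOpen_lt continuous_const (continuous_form_left σ d)) h z] with t ht
      exact le_of_lt ht
  have hlt : ∀ᶠ t : ℝ in 𝓝[>] 0, t < s :=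
    (gt_mem_nhds hs0).filter_mono nhdsWithin_le_nhds
  filter_upwards [hev, hlt, eventually_add_smul_mem hV.isOpen_left hx z, self_mem_nhdsWithin]
    with t h1 h2 h3 h4
  refine ⟨subset_closure h3, fun d hd => ?_⟩
  rcases le_total (σ (x + s • z) d) 1 with h | h
  · exact h1 d ⟨hd, h⟩
  · have h4 : 0 < t := h4
    have hxd := hx1 d hd
    simp only [map_add, map_smul, LinearMap.add_apply, LinearMap.smul_apply, smul_eq_mul] at h ⊢
    rcases le_total 0 (σ z d) with hz | hz
    · nlinarith
    · nlinarith

theorem IsDualCones.finite_minimalVectors (hσ : IsPosDefForm σ) (hV : IsDualCones σ V₁ V₂)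
    (hDL : D ⊆ (closure V₂ ∩ (L : Set V)) \ {0}) {x : V} (hx : x ∈ V₁) :
    (minimalVectors σ D x).Finite :=
  (hV.finite_setOf_le hσ hDL hx (minimum σ D x)).subset fun _ hd => ⟨hd.1, hd.2.le⟩

/-- A form of Farkas' lemma. Since `σ x` is `1` on `S`, the convex hull is a slice of the cone over
`S`, and a hyperplane separating the rescaled `y` from it can be shifted by a multiple of `x` to
pass through the origin. -/
theorem exists_smul_mem_convexHull {S : Set V} (hσ : IsPosDefForm σ) (hS : S.Finite) {x y : V}
    (hx : ∀ d ∈ S, σ x d = 1) (hy : 0 < σ x y)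
    (h : ∀ z, (∀ d ∈ S, 0 ≤ σ z d) → 0 ≤ σ z y) :
    (σ x y)⁻¹ • y ∈ convexHull ℝ S := by
  by_contra hmem
  obtain ⟨f, u, hf, hu⟩ := geometric_hahn_banach_point_closed (convex_convexHull ℝ S)
    (hS.isCompact_convexHull ℝ).isClosed hmem
  obtain ⟨z, hz⟩ := hσ.exists_eq (f : V →ₗ[ℝ] ℝ)
  have h1 := h (z - u • x) fun d hd => by
    have := hu d (subset_convexHull ℝ S hd)
    simp only [map_sub, map_smul, LinearMap.sub_apply, LinearMap.smul_apply, smul_eq_mul, hx d hd,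
      hz]
    simp only [ContinuousLinearMap.coe_coe]
    linarith
  simp only [map_sub, map_smul, LinearMap.sub_apply, LinearMap.smul_apply, smul_eq_mul, hz,
    ContinuousLinearMap.coe_coe] at h1 hf
  rw [inv_mul_eq_div, div_lt_iff₀ hy] at hf
  linarith

/-- Every point of `V₂` lies in the Voronoi domain of some perfect point with minimum `1`. -/
theorem IsDualCones.exists_mem_perfectPoints (hσ : IsPosDefForm σ) (hV : IsDualCones σ V₁ V₂)
    (hDL : D ⊆ (closure V₂ ∩ (L : Set V)) \ {0}) (hD : IsAdmissible σ V₁ V₂ D)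
    {y : V} (hy : y ∈ V₂) :
    ∃ x ∈ perfectPoints σ V₁ D, ∃ s : ℝ, 0 < s ∧ s • y ∈ convexHull ℝ (minimalVectors σ D x) := by
  have hne := hD.nonempty hV
  obtain ⟨x₀, hx₀⟩ := hV.nonempty_ryshkov hσ hDL hne
  have hcomp : ∀ C, IsCompact {x | x ∈ ryshkov σ V₁ D ∧ σ x y ≤ C} := fun C => by
    refine (hV.isCompact_setOf_le hσ hy C).of_isClosed_subset
      (isClosed_ryshkov.inter (isClosed_le (continuous_form_left σ y) continuous_const)) ?_
    exact fun x hx => ⟨hx.1.1, hx.2⟩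
  obtain ⟨x₁, hx₁, hmin₁⟩ := (hcomp (σ x₀ y)).exists_isMinOn ⟨x₀, hx₀, le_rfl⟩
    (continuous_form_left σ y).continuousOn
  have hmin : ∀ x ∈ ryshkov σ V₁ D, σ x₁ y ≤ σ x y := fun x hx => by
    rcases le_total (σ x y) (σ x₀ y) with h | h
    · exact hmin₁ (a := x) ⟨hx, h⟩
    · exact hx₁.2.trans h
  -- This sublevel set is exactly the compact face of minimisers.
  obtain ⟨x, hx⟩ := (hcomp (σ x₁ y)).extremePoints_nonempty ⟨x₁, hx₁.1, le_rfl⟩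
  rw [mem_extremePoints] at hx
  obtain ⟨⟨hxR, hxy⟩, hext⟩ := hx
  have hxV : x ∈ V₁ := hD.ryshkov_subset hV hxR
  set M : Set V := {d | d ∈ D ∧ σ x d = 1} with hM
  have hspan : Submodule.span ℝ M = ⊤ := by
    -- Otherwise a nonzero `z` is orthogonal to `M`, and `x ± t • z` stay in `ryshkov`. Minimality
    -- puts both on the face, against extremality of `x`.
    by_contra hlt
    obtain ⟨f, hf0, hf⟩ := Submodule.exists_le_ker_of_lt_top _ (lt_top_iff_ne_top.2 hlt)
    obtain ⟨z, hz⟩ := hσ.exists_eq f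
    have hzM : ∀ d ∈ D, σ x d = 1 → σ z d = 0 := fun d hd h => by
      rw [hz]; exact hf (Submodule.subset_span ⟨hd, h⟩)
    have h1 := hV.eventually_mem_ryshkov hσ hDL (z := z) hxV hxR.2 fun d hd h => (hzM d hd h).ge
    have h2 := hV.eventually_mem_ryshkov hσ hDL (z := -z) hxV hxR.2 fun d hd h => by
      simp [hzM d hd h]
    obtain ⟨t, ⟨h1, h2⟩, ht⟩ := ((h1.and h2).and self_mem_nhdsWithin).exists
    have ht : 0 < t := ht
    have e1 := hmin _ h1
    have e2 := hmin _ h2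
    simp only [map_add, map_neg, map_smul, LinearMap.add_apply, LinearMap.neg_apply,
      LinearMap.smul_apply, smul_eq_mul, mul_neg] at e1 e2
    have h3 := (hext (x + t • z) ⟨h1, by simp; linarith⟩ (x + t • -z) ⟨h2, by simp; linarith⟩
      ⟨1 / 2, 1 / 2, by norm_num, by norm_num, by norm_num, by module⟩).1
    rw [add_eq_left, smul_eq_zero] at h3
    rcases h3 with h3 | h3
    · exact ht.ne' h3
    · refine hf0 (LinearMap.ext fun v => ?_)
      rw [← hz v, h3]; simp
  have : Nontrivial V := by
    obtain ⟨v, hv⟩ := hV.nonempty_left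
    exact ⟨v, 0, fun h => hV.zero_notMem_left (h ▸ hv)⟩
  obtain ⟨d, hd, hd1⟩ : M.Nonempty := by
    rw [Set.nonempty_iff_ne_empty]
    intro h
    rw [h, Submodule.span_empty] at hspan
    exact bot_ne_top hspan
  have hmin1 : minimum σ D x = 1 := by
    rw [minimum_eq_of_forall_le hd fun e he => hd1.le.trans (hxR.2 e he), hd1]
  have hMeq : minimalVectors σ D x = M := by rw [minimalVectors, hmin1]
  have hypos : 0 < σ x y := hV.pos x hxV y hy
  refine ⟨x, ⟨⟨hxV, by rw [hMeq, hspan, finrank_top]⟩, hmin1⟩, (σ x y)⁻¹, inv_pos.2 hypos, ?_⟩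
  refine exists_smul_mem_convexHull hσ (hV.finite_minimalVectors hσ hDL hxV)
    (fun d hd => by rw [hd.2, hmin1]) hypos fun z hz => ?_
  have h1 := hV.eventually_mem_ryshkov hσ hDL (z := z) hxV hxR.2 fun d hd h =>
    hz d ⟨hd, by rw [h, hmin1]⟩
  obtain ⟨t, h1, ht⟩ := (h1.and self_mem_nhdsWithin).exists
  have ht : 0 < t := ht
  have e1 := hmin _ h1
  simp only [map_add, map_smul, LinearMap.add_apply, LinearMap.smul_apply, smul_eq_mul] at e1
  exact nonneg_of_mul_nonneg_right (by linarith : 0 ≤ t * σ z y) ht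

/-- A perfect point with minimum `1` is determined by its minimal vectors; over `K` these are
lattice vectors of bounded norm. -/
theorem IsDualCones.finite_perfectPoints_inter (hσ : IsPosDefForm σ) (hV : IsDualCones σ V₁ V₂)
    (hDL : D ⊆ (closure V₂ ∩ (L : Set V)) \ {0}) {K : Set V} (hK : IsCompact K) (hKV : K ⊆ V₁) :
    (perfectPoints σ V₁ D ∩ K).Finite := by
  obtain ⟨c, hc, h⟩ := hV.exists_mul_norm_le hσ hK hKV
  refine Set.Finite.of_finite_image (f := minimalVectors σ D)
    ((finite_lattice_norm_le L (1 / c)).finite_subsets.subset ?_) ?_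
  · rintro _ ⟨x, ⟨⟨-, hx1⟩, hxK⟩, rfl⟩ d ⟨hd, hxd⟩
    refine ⟨(hDL hd).1.2, ?_⟩
    rw [le_div_iff₀ hc, mul_comm]
    exact (h x hxK d (hDL hd).1.1).trans (hxd.trans hx1).le
  · rintro x ⟨⟨hx, hx1⟩, -⟩ x' ⟨⟨-, hx1'⟩, -⟩ hM
    refine hσ.eq_of_forall_eq_of_span_eq_top hx.span_eq_top fun d hd => ?_
    have hd' : d ∈ minimalVectors σ D x' := hM ▸ hd
    rw [hd.2, hd'.2, hx1, hx1']

/-! ### Lower bounds for the lattice points of a Voronoi domain. -/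

/-- Lattice points of `V₂` in a finitely generated rational cone dominate one of finitely many
lattice points of `V₂`. -/
theorem IsDualCones.exists_finite_dominated (hσ : IsPosDefForm σ) (hV : IsDualCones σ V₁ V₂)
    {S : Set V} (hS : S.Finite) (hSL : S ⊆ closure V₂ ∩ (L : Set V)) :
    ∃ T ⊆ V₂, T.Finite ∧ ∀ y ∈ V₂, y ∈ L → ∀ s : ℝ, 0 < s → s • y ∈ convexHull ℝ S →
      ∃ p ∈ T, y - p ∈ closure V₂ := by
  lift S to Finset V using hS
  refine ⟨{p | p ∈ V₂ ∧ p ∈ L ∧ ‖p‖ ≤ ∑ d ∈ S, 2 * ‖d‖}, fun p hp => hp.1,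
    (finite_lattice_norm_le L _).subset fun p hp => hp.2, fun y hy hyL s hs hmem => ?_⟩
  obtain ⟨w, hw, -, hwy⟩ := Finset.mem_convexHull'.1 hmem
  set c : V → ℝ := fun d => w d / s with hc
  have hc0 : ∀ d ∈ S, 0 ≤ c d := fun d hd => div_nonneg (hw d hd) hs.le
  have hy_eq : ∑ d ∈ S, c d • d = y := by
    rw [← inv_smul_smul₀ hs.ne' y, ← hwy, Finset.smul_sum]
    refine Finset.sum_congr rfl fun d _ => ?_
    rw [smul_smul, hc, inv_mul_eq_div]
  -- Plain floors could annihilate a positive coefficient and push the remainder to the boundary.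
  -- Removing one less keeps `c d - k d` positive wherever `c d` is, and still at most `2`.
  set k : V → ℤ := fun d => max (⌊c d⌋ - 1) 0 with hk
  have hk0 : ∀ d, (0 : ℝ) ≤ k d := fun d => by
    have : 0 ≤ k d := le_max_right _ _
    exact_mod_cast this
  have hk2 : ∀ d, c d - k d ≤ 2 := fun d => by
    have h1 : ((⌊c d⌋ - 1 : ℤ) : ℝ) ≤ k d := by exact_mod_cast le_max_left _ _
    have h2 := Int.lt_floor_add_one (c d)
    push_cast at h1
    linarith
  have hkle : ∀ d ∈ S, (k d : ℝ) ≤ c d ∧ (0 < c d → (k d : ℝ) < c d) := fun d hd => by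
    rcases max_choice (⌊c d⌋ - 1) 0 with h | h
    · have h1 : (k d : ℝ) = ⌊c d⌋ - 1 := by rw [hk]; simp only [h]; push_cast; ring
      have h2 := Int.floor_le (c d)
      exact ⟨by linarith, fun _ => by linarith⟩
    · have h1 : (k d : ℝ) = 0 := by rw [hk]; simp only [h]; simp
      rw [h1]
      exact ⟨hc0 d hd, id⟩
  have hsub : y - ∑ d ∈ S, (c d - k d) • d = ∑ d ∈ S, (k d : ℝ) • d := by
    rw [← hy_eq, ← Finset.sum_sub_distrib]
    exact Finset.sum_congr rfl fun d _ => by module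
  refine ⟨∑ d ∈ S, (c d - k d) • d, ⟨?_, ?_, ?_⟩, ?_⟩
  · rw [hV.mem_right_iff hσ] at hy ⊢
    intro v hv
    have hvy := hy v hv
    have hnn : ∀ d ∈ S, 0 ≤ σ v d := fun d hd => hV.nonneg hv.1 (hSL hd).1
    rw [← hy_eq, map_sum] at hvy
    rw [map_sum]
    simp only [map_smul, smul_eq_mul] at hvy ⊢
    obtain ⟨d, hd, hpos⟩ := Finset.exists_lt_of_sum_lt
      (by simpa using hvy : ∑ d ∈ S, (0 : ℝ) < ∑ d ∈ S, c d * σ v d)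
    refine Finset.sum_pos' (fun e he => mul_nonneg (by linarith [(hkle e he).1]) (hnn e he))
      ⟨d, hd, ?_⟩
    have hcd : 0 < c d := pos_of_mul_pos_left hpos (hnn d hd)
    have hvd : 0 < σ v d := pos_of_mul_pos_right hpos (hc0 d hd)
    exact mul_pos (by linarith [(hkle d hd).2 hcd]) hvd
  · have : ∑ d ∈ S, (c d - k d) • d = y - ∑ d ∈ S, k d • d := by
      rw [sub_eq_iff_eq_add.1 hsub]
      simp only [Int.cast_smul_eq_zsmul, add_sub_cancel_left]
    rw [this]
    exact sub_mem hyL (Submodule.sum_mem _ fun d hd => L.smul_mem _ (hSL hd).2)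
  · refine (norm_sum_le _ _).trans (Finset.sum_le_sum fun d hd => ?_)
    rw [norm_smul, Real.norm_of_nonneg (by linarith [(hkle d hd).1])]
    exact mul_le_mul_of_nonneg_right (hk2 d) (norm_nonneg d)
  · rw [hsub, hV.mem_closure_right_iff hσ]
    intro v hv
    rw [map_sum]
    refine Finset.sum_nonneg fun d hd => ?_
    rw [map_smul, smul_eq_mul]
    exact mul_nonneg (hk0 d) (hV.nonneg hv (hSL hd).1)

end Lattice

theorem IsDualCones.exists_forall_sub_mem_closure (hV : IsDualCones σ V₁ V₂)
    (hσ : IsPosDefForm σ) {T : Set V} (hT : T.Finite) (hTV : T ⊆ V₂) :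
    ∃ y₀ ∈ V₂, ∀ p ∈ T, p - y₀ ∈ closure V₂ := by
  obtain ⟨v, hv⟩ := hV.nonempty_right
  have hev : ∀ᶠ t : ℝ in 𝓝[>] 0, ∀ p ∈ T, p + t • -v ∈ V₂ :=
    (Filter.eventually_all_finite hT).2 fun p hp =>
      eventually_add_smul_mem hV.isOpen_right (hTV hp) (-v)
  obtain ⟨t, ht, ht0⟩ := (hev.and self_mem_nhdsWithin).exists
  refine ⟨t • v, hV.flip.smul_mem_left hσ.flip hv ht0, fun p hp => ?_⟩
  simpa [sub_eq_add_neg] using subset_closure (ht p hp)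

end Cones

/-! ### Equivariance of minima, minimal vectors and perfect points. -/

section Group

variable {V : Type*} [NormedAddCommGroup V] [NormedSpace ℝ V]
  {σ : LinearMap.BilinForm ℝ V} {V₁ V₂ D : Set V} {ω τ : V ≃ₗ[ℝ] V}

theorem IsAdjoint.minimum_eq (h : IsAdjoint σ ω τ) (hτ : (fun v => τ v) '' D = D) (x : V) :
    minimum σ D (ω x) = minimum σ D x := by
  unfold minimum
  conv_rhs => rw [← hτ]
  rw [Set.image_image]
  simp only [h x]

theorem IsAdjoint.image_minimalVectors (h : IsAdjoint σ ω τ) (hτ : (fun v => τ v) '' D = D)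
    (x : V) : τ '' minimalVectors σ D (ω x) = minimalVectors σ D x := by
  have hmin := h.minimum_eq hτ x
  ext d
  constructor
  · rintro ⟨e, ⟨he, hxe⟩, rfl⟩
    exact ⟨hτ ▸ Set.mem_image_of_mem _ he, by rw [← h, hxe, hmin]⟩
  · rintro ⟨hd, hxd⟩
    rw [← hτ] at hd
    obtain ⟨e, he, rfl⟩ := hd
    exact ⟨e, ⟨he, by rw [h, hxd, hmin]⟩, rfl⟩

variable [FiniteDimensional ℝ V]

theorem IsAdjoint.map_mem_right (hσ : IsPosDefForm σ) (hV : IsDualCones σ V₁ V₂)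
    (h : IsAdjoint σ ω τ) (hω : (fun v => ω v) '' V₁ = V₁) {y : V} (hy : y ∈ V₂) : τ y ∈ V₂ := by
  rw [hV.mem_right_iff hσ] at hy ⊢
  rintro x ⟨hx, hx0⟩
  rw [← h]
  refine hy _ ⟨?_, by simpa using hx0⟩
  have hc : Continuous fun v => ω v := LinearMap.continuous_of_finiteDimensional (ω : V →ₗ[ℝ] V)
  have := image_closure_subset_closure_image hc (Set.mem_image_of_mem _ hx)
  rwa [hω] at this

theorem IsAdjoint.mem_perfectPoints (h : IsAdjoint σ ω τ) (hτ : (fun v => τ v) '' D = D)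
    (hω : (fun v => ω v) '' V₁ = V₁) {x : V} (hx : ω x ∈ perfectPoints σ V₁ D) :
    x ∈ perfectPoints σ V₁ D := by
  have hxV : x ∈ V₁ := by
    have := hx.1.1
    rw [← hω] at this
    obtain ⟨v, hv, hvx⟩ := this
    rwa [← ω.injective hvx]
  refine ⟨⟨hxV, ?_⟩, by rw [← h.minimum_eq hτ, hx.2]⟩
  rw [← h.image_minimalVectors hτ, ← LinearEquiv.coe_coe, Submodule.span_image,
    hx.1.span_eq_top, Submodule.map_top, LinearEquiv.range, finrank_top]

end Group

end DualCones

/-! ### The equivalence. -/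

theorem mainTheorem7 {V : Type*} [NormedAddCommGroup V] [NormedSpace ℝ V]
    [FiniteDimensional ℝ V]
    (σ : LinearMap.BilinForm ℝ V) (hσ : DualCones.IsPosDefForm σ)
    (V₁ V₂ : Set V) (hV : DualCones.IsDualCones σ V₁ V₂)
    (Ω : Subgroup (V ≃ₗ[ℝ] V)) (hΩ : DualCones.ActsProperlyDiscontinuously Ω V₁)
    (L : Submodule ℤ V) [DiscreteTopology L] [IsZLattice ℝ L]
    (D : Set V) (hDL : D ⊆ (closure V₂ ∩ (L : Set V)) \ {0})
    (hD : DualCones.IsAdmissible σ V₁ V₂ D)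
    (hLinv : ∀ τ ∈ DualCones.adjointGroup σ Ω, (fun v => τ v) '' (L : Set V) = (L : Set V))
    (hDinv : ∀ τ ∈ DualCones.adjointGroup σ Ω, (fun v => τ v) '' D = D) :
    Finite (Quotient (DualCones.orbitSetoid Ω (DualCones.perfectPoints σ V₁ D))) ↔
      ∃ F : Set V, DualCones.IsPseudoFundamental σ Ω V₂ F ∧
        ∃ y₀ ∈ V₂, ∀ d ∈ F ∩ (L : Set V), d - y₀ ∈ closure V₂ := by
  constructor
  · intro hfin
    let P := DualCones.perfectPoints σ V₁ D
    let r : Quotient (DualCones.orbitSetoid Ω P) → V := fun q => (q.out : V)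
    have hr : ∀ q, r q ∈ P := fun q => q.out.2
    have hdom := fun q => hV.exists_finite_dominated (L := L) hσ
      (hV.finite_minimalVectors hσ hDL (hr q).1.1) fun d hd => (hDL hd.1).1
    choose T hTV hTfin hT using hdom
    obtain ⟨y₀, hy₀, hy₀T⟩ := hV.exists_forall_sub_mem_closure hσ (Set.finite_iUnion hTfin)
      (Set.iUnion_subset hTV)
    -- The part in `V₂` of the Voronoi domains of the chosen representatives `r q`.
    refine ⟨{y | y ∈ V₂ ∧ ∃ q, ∃ s : ℝ, 0 < s ∧
      s • y ∈ convexHull ℝ (DualCones.minimalVectors σ D (r q))},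
      ⟨fun y hy => hy.1, fun y hy => ?_⟩, y₀, hy₀, ?_⟩
    · obtain ⟨x, hx, s, hs, hmem⟩ := hV.exists_mem_perfectPoints hσ hDL hD hy
      obtain ⟨ω, hω, hωx⟩ : ∃ ω ∈ Ω, ω (r (Quotient.mk _ ⟨x, hx⟩)) = x :=
        Quotient.exact (Quotient.out_eq (Quotient.mk (DualCones.orbitSetoid Ω P) ⟨x, hx⟩))
      obtain ⟨τ, hτ, -⟩ := DualCones.existsUnique_isAdjoint σ hσ ω
      have hτm : τ ∈ DualCones.adjointGroup σ Ω := ⟨ω, hω, hτ⟩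
      refine ⟨τ, hτm, hτ.map_mem_right hσ hV (hΩ.1 ω hω) hy, Quotient.mk _ ⟨x, hx⟩, s, hs, ?_⟩
      rw [← hτ.image_minimalVectors (hDinv τ hτm), hωx, ← map_smul]
      have := LinearMap.image_convexHull (𝕜 := ℝ) (τ : V →ₗ[ℝ] V) (DualCones.minimalVectors σ D x)
      simp only [LinearEquiv.coe_coe] at this
      rw [← this]
      exact Set.mem_image_of_mem _ hmem
    · rintro d ⟨⟨hd, q, s, hs, hmem⟩, hdL⟩
      obtain ⟨p, hp, hdp⟩ := hT q d hd hdL s hs hmem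
      have hpy := hy₀T p (Set.mem_iUnion.2 ⟨q, hp⟩)
      rw [hV.mem_closure_right_iff hσ] at hdp hpy ⊢
      intro v hv
      have h1 := hdp v hv
      have h2 := hpy v hv
      rw [map_sub] at h1 h2 ⊢
      linarith
  · rintro ⟨F, ⟨-, hF⟩, y₀, hy₀, hFL⟩
    have hK : IsCompact ({x | x ∈ closure V₁ ∧ σ x y₀ ≤ Module.finrank ℝ V} ∩
        DualCones.ryshkov σ V₁ D) :=
      (hV.isCompact_setOf_le hσ hy₀ _).inter_right DualCones.isClosed_ryshkov
    have hfin := hV.finite_perfectPoints_inter hσ hDL hK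
      (Set.inter_subset_right.trans (hD.ryshkov_subset hV))
    have : Finite ↥(DualCones.perfectPoints σ V₁ D ∩
        ({x | x ∈ closure V₁ ∧ σ x y₀ ≤ Module.finrank ℝ V} ∩ DualCones.ryshkov σ V₁ D)) := hfin
    refine Finite.of_surjective (fun x : ↥(DualCones.perfectPoints σ V₁ D ∩
        ({x | x ∈ closure V₁ ∧ σ x y₀ ≤ Module.finrank ℝ V} ∩ DualCones.ryshkov σ V₁ D)) =>
        Quotient.mk (DualCones.orbitSetoid Ω (DualCones.perfectPoints σ V₁ D))
          ⟨(x : V), x.2.1⟩) ?_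
    intro q
    induction q using Quotient.inductionOn with
    | h x =>
      obtain ⟨x, hx⟩ := x
      obtain ⟨s, hs, hsL, hxs⟩ := hV.exists_mem_right_of_isPerfect hσ hDL hx
      obtain ⟨τ, hτm, hτs⟩ := hF s hs
      obtain ⟨ω, hω, hadj⟩ := hτm
      have hτm : τ ∈ DualCones.adjointGroup σ Ω := ⟨ω, hω, hadj⟩
      have hωx : ω (ω.symm x) = x := ω.apply_symm_apply x
      have hx' : ω.symm x ∈ DualCones.perfectPoints σ V₁ D :=
        hadj.mem_perfectPoints (hDinv τ hτm) (hΩ.1 ω hω) (hωx.symm ▸ hx)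
      have hcl : ω.symm x ∈ closure V₁ := subset_closure hx'.1.1
      have hle : σ (ω.symm x) y₀ ≤ Module.finrank ℝ V := by
        -- Pairing `τ s - y₀` with `ω⁻¹ x` gives the bound, since the value on `τ s` is `σ x s = n`.
        have h1 := hV.nonneg hcl (hFL (τ s) ⟨hτs, hLinv τ hτm ▸ Set.mem_image_of_mem _ hsL⟩)
        rw [map_sub, ← hadj, hωx, hxs] at h1
        linarith
      refine ⟨⟨ω.symm x, hx', ⟨hcl, hle⟩, hcl, fun d hd => ?_⟩, Quotient.sound ⟨ω, hω, hωx⟩⟩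
      rw [← hx'.2]
      exact hV.minimum_le (fun e he => (hDL he).1.1) hx'.1.1 hd
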